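/- Let $G$ be a non-trivial locally compact (Hausdorff) group with left Haar measure $\mu$, let $1\le p<\infty$, let $S\subset G$, and let $\omega:G\to(0,\infty)$ be a weight, that is, a positive measurable function with $\int_K\omega^p\,d\mu<\infty$ for every compact $K\subset G$. Let $L^p(G,\omega)$ be the space of (classes of) measurable functions $f:G\to\mathbb{C}$ with $\|f\|_{p,\omega}=\left(\int_G|f|^p\omega^p\,d\mu\right)^{1/p}<\infty$, and put $(T_sf)(t)=f(s^{-1}t)$. Assume that $\omega$ is $S$-admissible, that is, $$\operatorname*{ess\,sup}_{t\in G}\frac{\omega(st)}{\omega(t)}<\infty\quad\text{for every } s\in S,$$ so that each $T_s$, $s\in S$, is a bounded operator on $L^p(G,\omega)$. For $\Gamma\subset\mathbb{C}$, a vector $f\in L^p(G,\omega)$ is called $(\Gamma,S)$-dense if $\{\lambda T_sf:\lambda\in\Gamma,\ s\in S\}$ is dense in $L^p(G,\omega)$. Then for every $\Gamma\subset\mathbb{C}$, the space $L^p(G,\omega)$ has a $(\Gamma,S)$-dense vector if and only if it has a $(|\Gamma|,S)$-dense vector, where $|\Gamma|=\{|\lambda|:\lambda\in\Gamma\}$.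 In particular, $L^p(G,\omega)$ has an $(\mathbb{R}_+,S)$-dense vector if and only if it has a $(\mathbb{C},S)$-dense vector, where $\mathbb{R}_+=[0,\infty)$. -/

import Mathlib

open MeasureTheory
open scoped ENNReal

/-- `ω` is a weight on `G`: a positive (measurable) function with `∫_K ω^p dμ < ∞` for every
compact `K`. -/
structure IsWeight {G : Type*} [TopologicalSpace G] [MeasurableSpace G]
    (μ : Measure G) (p : ℝ≥0∞) (ω : G → ℝ) : Prop where
  pos : ∀ t, 0 < ω t
  aemeasurable : AEMeasurable ω μ
  lintegral_lt_top : ∀ K : Set G, IsCompact K →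
    ∫⁻ t in K, ENNReal.ofReal (ω t) ^ p.toReal ∂μ < ∞

/-- The number `M(s) = ess sup_t ω(st) / ω(t)`, with values in `[0, ∞]`. -/
noncomputable def translationBound {G : Type*} [Group G] [MeasurableSpace G]
    (μ : Measure G) (ω : G → ℝ) (s : G) : ℝ≥0∞ :=
  essSup (fun t => ENNReal.ofReal (ω (s * t) / ω t)) μ

/-- `ω` is `S`-admissible: `M(s) < ∞` for all `s ∈ S`. -/
def IsAdmissible {G : Type*} [Group G] [MeasurableSpace G]
    (μ : Measure G) (ω : G → ℝ) (S : Set G) : Prop :=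
  ∀ s ∈ S, translationBound μ ω s < ∞

/-- The measure `ω^p dμ`. -/
noncomputable def weightedMeasure {G : Type*} [MeasurableSpace G]
    (μ : Measure G) (p : ℝ≥0∞) (ω : G → ℝ) : Measure G :=
  μ.withDensity fun t => ENNReal.ofReal (ω t) ^ p.toReal

/-- The space `L^p(G, ω)`, with norm `(∫ |f|^p ω^p dμ)^(1/p)`. As `ω > 0`, the null sets of
`ω^p dμ` are those of `μ`. -/
abbrev WeightedLp {G : Type*} [MeasurableSpace G]
    (μ : Measure G) (p : ℝ≥0∞) (ω : G → ℝ) : Type _ :=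
  Lp ℂ p (weightedMeasure μ p ω)

/-- Left translation, `(T_s f)(t) = f(s⁻¹ t)`. -/
def leftTranslate {G : Type*} [Group G] (s : G) (f : G → ℂ) : G → ℂ :=
  fun t => f (s⁻¹ * t)

/-- Left translation by `s` is nonsingular for the measure `ω^p dμ`, so that `T_s` respects
equality almost everywhere. -/
theorem leftTranslate_congr_ae {G : Type*} [Group G] [TopologicalSpace G] [IsTopologicalGroup G]
    [MeasurableSpace G] [BorelSpace G] {μ : Measure G} [μ.IsMulLeftInvariant] {p : ℝ≥0∞}
    {ω : G → ℝ} (hω : IsWeight μ p ω) (s : G) {f g : G → ℂ}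
    (hfg : f =ᵐ[weightedMeasure μ p ω] g) :
    leftTranslate s f =ᵐ[weightedMeasure μ p ω] leftTranslate s g := by
  have h1 : f =ᵐ[μ] g := by
    refine Measure.AbsolutelyContinuous.ae_le
      (withDensity_absolutelyContinuous' (hω.aemeasurable.ennreal_ofReal.pow_const _) ?_) hfg
    refine Filter.Eventually.of_forall fun t => ?_
    have h0 : ENNReal.ofReal (ω t) ≠ 0 := by simpa using hω.pos t
    simp [ENNReal.rpow_eq_zero_iff, h0]
  exact (withDensity_absolutelyContinuous _ _).ae_le
    ((measurePreserving_mul_left μ s⁻¹).quasiMeasurePreserving.ae_eq_comp h1)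

/-- If `M(s) < ∞`, then `T_s` maps `L^p(G, ω)` into itself. -/
theorem memLp_leftTranslate {G : Type*} [Group G] [TopologicalSpace G] [IsTopologicalGroup G]
    [MeasurableSpace G] [BorelSpace G] {μ : Measure G} [μ.IsMulLeftInvariant] {p : ℝ≥0∞}
    {ω : G → ℝ} (hω : IsWeight μ p ω) {s : G} (hs : translationBound μ ω s < ∞) {f : G → ℂ}
    (hf : MemLp f p (weightedMeasure μ p ω)) :
    MemLp (leftTranslate s f) p (weightedMeasure μ p ω) := by
  have hle : (weightedMeasure μ p ω).map (s⁻¹ * ·) ≤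
      (translationBound μ ω s ^ p.toReal) • weightedMeasure μ p ω := by
    refine Measure.le_iff.2 fun A hA => ?_
    have hm : MeasurableSet ((s⁻¹ * ·) ⁻¹' A) := measurable_const_mul s⁻¹ hA
    rw [Measure.map_apply (measurable_const_mul s⁻¹) hA, Measure.smul_apply, smul_eq_mul,
      weightedMeasure, withDensity_apply _ hm, withDensity_apply _ hA,
      ← lintegral_const_mul' _ _ (ENNReal.rpow_ne_top_of_nonneg ENNReal.toReal_nonneg hs.ne),
      ← lintegral_indicator hm, ← lintegral_indicator hA,
      ← lintegral_mul_left_eq_self _ s]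
    refine lintegral_mono_ae ?_
    filter_upwards [ENNReal.ae_le_essSup (μ := μ)
      (fun t => ENNReal.ofReal (ω (s * t) / ω t))] with t ht
    by_cases h : t ∈ A
    · have h' : s * t ∈ (s⁻¹ * ·) ⁻¹' A := by simpa using h
      rw [Set.indicator_of_mem h', Set.indicator_of_mem h,
        ← ENNReal.mul_rpow_of_nonneg _ _ ENNReal.toReal_nonneg]
      refine ENNReal.rpow_le_rpow ?_ ENNReal.toReal_nonneg
      rw [ENNReal.ofReal_div_of_pos (hω.pos t)] at ht
      exact (ENNReal.div_le_iff (by simpa using hω.pos t) ENNReal.ofReal_ne_top).1 ht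
    · have h' : s * t ∉ (s⁻¹ * ·) ⁻¹' A := by simpa using h
      rw [Set.indicator_of_notMem h']
      exact zero_le
  have h2 := hf.of_measure_le_smul
    (ENNReal.rpow_ne_top_of_nonneg ENNReal.toReal_nonneg hs.ne) hle
  exact (memLp_map_measure_iff h2.1 (measurable_const_mul s⁻¹).aemeasurable).1 h2

/-- The `(Γ, S)`-orbit `{λ T_s f : λ ∈ Γ, s ∈ S}` of `f`, as a set of elements of `L^p(G, ω)`. For
an `S`-admissible weight, `λ T_s f` lies in `L^p(G, ω)` for all `λ ∈ Γ` and `s ∈ S`. -/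
def translateOrbit {G : Type*} [Group G] [MeasurableSpace G]
    (μ : Measure G) (p : ℝ≥0∞) (ω : G → ℝ) (Γ : Set ℂ) (S : Set G)
    (f : WeightedLp μ p ω) : Set (WeightedLp μ p ω) :=
  {g | ∃ c ∈ Γ, ∃ s ∈ S, g =ᵐ[weightedMeasure μ p ω] c • leftTranslate s f}

/-- `f` is `(Γ, S)`-dense in `L^p(G, ω)`: its `(Γ, S)`-orbit is dense. -/
def IsDenseVector {G : Type*} [Group G] [MeasurableSpace G]
    (μ : Measure G) (p : ℝ≥0∞) [Fact (1 ≤ p)] (ω : G → ℝ) (Γ : Set ℂ) (S : Set G)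
    (f : WeightedLp μ p ω) : Prop :=
  Dense (translateOrbit μ p ω Γ S f)

/-- `|Γ| = {|λ| : λ ∈ Γ}`, as a subset of `ℂ`. -/
def absSet (Γ : Set ℂ) : Set ℂ :=
  (fun z : ℂ => ((‖z‖ : ℝ) : ℂ)) '' Γ

/-- `ℝ₊ = [0, ∞)`, as a subset of `ℂ`. -/
def nonnegReals : Set ℂ :=
  (fun r : ℝ => (r : ℂ)) '' Set.Ici 0

/-! Only the moduli of the scalars should matter. Let `f` be `(Γ, S)`-dense, and let `Γ'` contain a
scalar of every modulus occurring in `Γ`. The vector `f' = ∑ u n` is assembled from pieces of `f`: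
given a dense sequence of targets `g n` supported in compact sets `F n`, choose `c n`, `s n` such
that `c n T_{s n} f` is close to a function of modulus at least `1` on `F n` and zero off it. The
piece `u n` equals `c' n⁻¹ g n (s n t)` where `s n t ∈ F n` and `|c n f t| ≥ 1/2`, with `|c' n| = |c
n|`. Then `c' n T_{s n} u n` is nearly `g n`. Since `|u n|` is at most a constant times `|f|` on `(s
n)⁻¹ F n`, every cross term `c' m T_{s m} u n` is controlled by `c m T_{s m} f`, so the phase of the
scalar drops out. Both directions are this one statement (`IsDenseVector.exists_of_norm_eq`).

Small cross terms require that `s n` move any prescribed compact set off `F n`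
(`IsDenseVector.exists_eLpNorm_sub_lt_of_isCompact`). If this failed, all approximating translations
would lie in one compact set. Two of them would then nearly coincide, though their targets have
different ratios between two disjoint places. A scalar cannot change such a ratio. Two places exist
because `G` is non-trivial; on the trivial group the theorem fails for `Γ = ℂ`.

A dense sequence of targets exists because a dense vector forces `G` to be `σ`-compact
(`IsDenseVector.sigmaCompactSpace`) and second countable (`IsDenseVector.secondCountableTopology`).
-/

open Filter Topology Pointwise

/-! ### The weighted measure and its null sets. -/

section WeightedMeasure

theorem density_ne_top {G : Type*} {p : ℝ≥0∞} {ω : G → ℝ} (t : G) :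
    ENNReal.ofReal (ω t) ^ p.toReal ≠ ∞ :=
  ENNReal.rpow_ne_top_of_nonneg ENNReal.toReal_nonneg ENNReal.ofReal_ne_top

theorem weightedMeasure_absolutelyContinuous {G : Type*} [MeasurableSpace G] {μ : Measure G}
    {p : ℝ≥0∞} {ω : G → ℝ} : weightedMeasure μ p ω ≪ μ :=
  withDensity_absolutelyContinuous _ _

variable {G : Type*} [TopologicalSpace G] [MeasurableSpace G] {μ : Measure G} {p : ℝ≥0∞} {ω : G → ℝ}

theorem IsWeight.density_ne_zero (hω : IsWeight μ p ω) (t : G) :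
    ENNReal.ofReal (ω t) ^ p.toReal ≠ 0 := by
  have h0 : ENNReal.ofReal (ω t) ≠ 0 := by simpa using hω.pos t
  simp [ENNReal.rpow_eq_zero_iff, h0]

theorem IsWeight.aemeasurable_density (hω : IsWeight μ p ω) :
    AEMeasurable (fun t => ENNReal.ofReal (ω t) ^ p.toReal) μ :=
  hω.aemeasurable.ennreal_ofReal.pow_const _

theorem IsWeight.absolutelyContinuous_weightedMeasure (hω : IsWeight μ p ω) :
    μ ≪ weightedMeasure μ p ω :=
  withDensity_absolutelyContinuous' hω.aemeasurable_density (.of_forall hω.density_ne_zero)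

theorem IsWeight.weightedMeasure_lt_top (hω : IsWeight μ p ω) {K : Set G}
    (hK : IsCompact K) (hm : MeasurableSet K) : weightedMeasure μ p ω K < ∞ := by
  rw [weightedMeasure, withDensity_apply _ hm]
  exact hω.lintegral_lt_top K hK

/-- On a set of finite `μ`-measure, `μ` is uniformly absolutely continuous with respect to the
weighted measure. -/
theorem IsWeight.exists_pos_measure_inter_lt (hω : IsWeight μ p ω) {F : Set G}
    (hF : MeasurableSet F) (hμF : μ F ≠ ∞) {ε : ℝ≥0∞} (hε : ε ≠ 0) :
    ∃ δ > 0, ∀ s, weightedMeasure μ p ω s < δ → μ (s ∩ F) < ε := by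
  -- The reciprocal density recovers `μ` from the weighted measure. Its restriction to `F` has
  -- integral `μ F < ∞`, so the claim is absolute continuity of that integral.
  set ρ : G → ℝ≥0∞ := fun t => (ENNReal.ofReal (ω t) ^ p.toReal)⁻¹
  have hinv : (weightedMeasure μ p ω).withDensity ρ = μ :=
    withDensity_inv_same₀ hω.aemeasurable_density (.of_forall hω.density_ne_zero)
      (.of_forall density_ne_top)
  have key : ∀ s, MeasurableSet s →
      ∫⁻ t in s, F.indicator ρ t ∂(weightedMeasure μ p ω) = μ (s ∩ F) := by
    intro s hs
    rw [setLIntegral_indicator hF, Set.inter_comm, ← withDensity_apply _ (hs.inter hF), hinv]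
  have hfin : ∫⁻ t, F.indicator ρ t ∂(weightedMeasure μ p ω) ≠ ∞ := by
    rw [← setLIntegral_univ, key _ .univ, Set.univ_inter]
    exact hμF
  obtain ⟨δ, hδ, h⟩ := exists_pos_setLIntegral_lt_of_measure_lt hfin hε
  refine ⟨δ, hδ, fun s hs => ?_⟩
  have h2 := h (toMeasurable (weightedMeasure μ p ω) s) (by rwa [measure_toMeasurable])
  rw [key _ (measurableSet_toMeasurable _ _)] at h2
  exact (measure_mono (Set.inter_subset_inter_left _ (subset_toMeasurable _ _))).trans_lt h2

end WeightedMeasure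

/-- A function that is small in `L^p` is pointwise small off a set of small measure. -/
theorem exists_pos_measure_le_norm_lt {α E : Type*} {m : MeasurableSpace α}
    [NormedAddCommGroup E] {ν : Measure α} {p : ℝ≥0∞} (hp0 : p ≠ 0) (hp : p ≠ ∞) {η : ℝ}
    (hη : 0 < η) {ε : ℝ≥0∞} (hε : ε ≠ 0) :
    ∃ δ > 0, ∀ u : α → E, AEStronglyMeasurable u ν → eLpNorm u p ν < δ →
      ν {t | η ≤ ‖u t‖} < ε := by
  have hq : 0 < p.toReal := ENNReal.toReal_pos hp0 hp
  -- The value of `δ` for which Chebyshev's inequality gives exactly `ε`.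
  refine ⟨ENNReal.ofReal η * ε ^ (p.toReal)⁻¹, ?_, fun u hu hlt => ?_⟩
  · refine ENNReal.mul_pos (by simpa using hη) ?_
    simp [ENNReal.rpow_eq_zero_iff, hε, hq.le]
  have h1 := mul_meas_ge_le_pow_eLpNorm' ν hp0 hp hu (ENNReal.ofReal η)
  have h2 : {x | ENNReal.ofReal η ≤ ‖u x‖ₑ} = {t | η ≤ ‖u t‖} := by
    ext t
    simp only [Set.mem_ofPred_eq]
    rw [← ofReal_norm, ENNReal.ofReal_le_ofReal_iff (norm_nonneg _)]
  rw [h2] at h1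
  have h3 := h1.trans_lt (ENNReal.rpow_lt_rpow hlt hq)
  rw [ENNReal.mul_rpow_of_nonneg _ _ hq.le, ← ENNReal.rpow_mul, inv_mul_cancel₀ hq.ne',
    ENNReal.rpow_one] at h3
  exact lt_of_mul_lt_mul_left' h3

/-- In a locally compact space, an integrable function is the limit almost everywhere of a sequence
of compactly supported continuous functions. -/
theorem exists_seq_hasCompactSupport_tendsto_ae {α E : Type*} [TopologicalSpace α] [R1Space α]
    [NormalSpace α] [WeaklyLocallyCompactSpace α] [MeasurableSpace α] [BorelSpace α] [NormedAddCommGroup E]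
    [NormedSpace ℝ E] {μ : Measure α} [μ.Regular] {g : α → E} (hg : Integrable g μ) :
    ∃ φ : ℕ → α → E, (∀ n, Continuous (φ n)) ∧ (∀ n, HasCompactSupport (φ n)) ∧
      ∀ᵐ t ∂μ, Tendsto (fun n => φ n t) atTop (𝓝 (g t)) := by
  have h1 : ∀ n : ℕ, ∃ φ : α → E, HasCompactSupport φ ∧
      eLpNorm (g - φ) 1 μ ≤ (n + 1 : ℝ≥0∞)⁻¹ ∧ Continuous φ ∧ MemLp φ 1 μ := fun n =>
    (memLp_one_iff_integrable.2 hg).exists_hasCompactSupport_eLpNorm_sub_le ENNReal.one_ne_top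
      (ENNReal.inv_ne_zero.2 (by finiteness))
  choose φ hsupp hle hcont hmem using h1
  have h2 : Tendsto (fun n => eLpNorm (φ n - g) 1 μ) atTop (𝓝 0) := by
    refine tendsto_of_tendsto_of_tendsto_of_le_of_le tendsto_const_nhds
      ((tendsto_add_atTop_iff_nat 1).2 ENNReal.tendsto_inv_nat_nhds_zero) (fun _ => zero_le)
      fun n => ?_
    rw [eLpNorm_sub_comm]
    simpa using hle n
  obtain ⟨ns, -, hns⟩ := (tendstoInMeasure_of_tendsto_eLpNorm one_ne_zero
    (fun n => (hmem n).aestronglyMeasurable) hg.aestronglyMeasurable h2).exists_seq_tendsto_ae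
  exact ⟨fun k => φ (ns k), fun k => hcont _, fun k => hsupp _, hns⟩

/-! ### Translation as a bounded operator. -/

section Translation

variable {G : Type*} [Group G] [TopologicalSpace G] [IsTopologicalGroup G]
  [MeasurableSpace G] [BorelSpace G] {μ : Measure G} [μ.IsMulLeftInvariant] {p : ℝ≥0∞}
  {ω : G → ℝ}

/-- After the substitution `t ↦ s t`, which preserves `μ`, this is the pointwise inequality `ω (s t)
≤ M(s) ω t` raised to the power `p`. -/
theorem map_weightedMeasure_le (hω : IsWeight μ p ω) {s : G} (hs : translationBound μ ω s < ∞) :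
    (weightedMeasure μ p ω).map (s⁻¹ * ·) ≤
      (translationBound μ ω s ^ p.toReal) • weightedMeasure μ p ω := by
  refine Measure.le_iff.2 fun A hA => ?_
  have hm : MeasurableSet ((s⁻¹ * ·) ⁻¹' A) := measurable_const_mul s⁻¹ hA
  rw [Measure.map_apply (measurable_const_mul s⁻¹) hA, Measure.smul_apply, smul_eq_mul,
    weightedMeasure, withDensity_apply _ hm, withDensity_apply _ hA,
    ← lintegral_const_mul' _ _ (ENNReal.rpow_ne_top_of_nonneg ENNReal.toReal_nonneg hs.ne),
    ← lintegral_indicator hm, ← lintegral_indicator hA,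
    ← lintegral_mul_left_eq_self _ s]
  refine lintegral_mono_ae ?_
  filter_upwards [ENNReal.ae_le_essSup (μ := μ)
    (fun t => ENNReal.ofReal (ω (s * t) / ω t))] with t ht
  by_cases h : t ∈ A
  · have h' : s * t ∈ (s⁻¹ * ·) ⁻¹' A := by simpa using h
    rw [Set.indicator_of_mem h', Set.indicator_of_mem h,
      ← ENNReal.mul_rpow_of_nonneg _ _ ENNReal.toReal_nonneg]
    refine ENNReal.rpow_le_rpow ?_ ENNReal.toReal_nonneg
    rw [ENNReal.ofReal_div_of_pos (hω.pos t)] at ht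
    exact (ENNReal.div_le_iff (by simpa using hω.pos t) ENNReal.ofReal_ne_top).1 ht
  · have h' : s * t ∉ (s⁻¹ * ·) ⁻¹' A := by simpa using h
    rw [Set.indicator_of_notMem h']
    exact zero_le

theorem eLpNorm_leftTranslate_le (hp0 : p ≠ 0) (hp : p ≠ ∞) (hω : IsWeight μ p ω) {s : G}
    (hs : translationBound μ ω s < ∞)
    {f : G → ℂ} (hf : MemLp f p (weightedMeasure μ p ω)) :
    eLpNorm (leftTranslate s f) p (weightedMeasure μ p ω) ≤
      translationBound μ ω s * eLpNorm f p (weightedMeasure μ p ω) := by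
  have hle := map_weightedMeasure_le hω hs
  have hq : 0 < p.toReal := ENNReal.toReal_pos hp0 hp
  have h2 := hf.of_measure_le_smul
    (ENNReal.rpow_ne_top_of_nonneg ENNReal.toReal_nonneg hs.ne) hle
  calc eLpNorm (leftTranslate s f) p (weightedMeasure μ p ω)
      = eLpNorm f p ((weightedMeasure μ p ω).map (s⁻¹ * ·)) :=
        (eLpNorm_map_measure h2.1 (measurable_const_mul s⁻¹).aemeasurable).symm
    _ ≤ eLpNorm f p ((translationBound μ ω s ^ p.toReal) • weightedMeasure μ p ω) :=
        eLpNorm_mono_measure f hle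
    _ = translationBound μ ω s * eLpNorm f p (weightedMeasure μ p ω) := by
        rw [eLpNorm_smul_measure_of_ne_top hp, smul_eq_mul, one_div, ENNReal.toReal_inv,
          ENNReal.rpow_rpow_inv hq.ne']

/-- Left translation `T_s` as a linear operator on `L^p(G, ω)`. -/
noncomputable def leftTranslateLinearMap (hω : IsWeight μ p ω) {s : G}
    (hs : translationBound μ ω s < ∞) : WeightedLp μ p ω →ₗ[ℂ] WeightedLp μ p ω where
  toFun f := (memLp_leftTranslate hω hs (Lp.memLp f)).toLp (leftTranslate s f)
  map_add' f g := by
    refine Lp.ext ?_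
    filter_upwards [MemLp.coeFn_toLp (memLp_leftTranslate hω hs (Lp.memLp f)),
      MemLp.coeFn_toLp (memLp_leftTranslate hω hs (Lp.memLp g)),
      MemLp.coeFn_toLp (memLp_leftTranslate hω hs (Lp.memLp (f + g))),
      Lp.coeFn_add ((memLp_leftTranslate hω hs (Lp.memLp f)).toLp _)
        ((memLp_leftTranslate hω hs (Lp.memLp g)).toLp _),
      leftTranslate_congr_ae hω s (Lp.coeFn_add f g)] with t h1 h2 h3 h4 h5
    rw [h3, h4, h5, Pi.add_apply, h1, h2]
    rfl
  map_smul' c f := by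
    refine Lp.ext ?_
    rw [RingHom.id_apply]
    filter_upwards [MemLp.coeFn_toLp (memLp_leftTranslate hω hs (Lp.memLp f)),
      MemLp.coeFn_toLp (memLp_leftTranslate hω hs (Lp.memLp (c • f))),
      Lp.coeFn_smul c ((memLp_leftTranslate hω hs (Lp.memLp f)).toLp _),
      leftTranslate_congr_ae hω s (Lp.coeFn_smul c f)] with t h1 h2 h3 h4
    rw [h2, h3, h4, Pi.smul_apply, h1]
    rfl

/-- Left translation `T_s` as a bounded operator on `L^p(G, ω)`. -/
noncomputable def leftTranslateCLM [Fact (1 ≤ p)] (hp : p ≠ ∞) (hω : IsWeight μ p ω) {s : G}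
    (hs : translationBound μ ω s < ∞) : WeightedLp μ p ω →L[ℂ] WeightedLp μ p ω :=
  (leftTranslateLinearMap hω hs).mkContinuous (translationBound μ ω s).toReal fun f => by
    have h0 : p ≠ 0 := (zero_lt_one.trans_le (Fact.out : 1 ≤ p)).ne'
    have h1 : ‖leftTranslateLinearMap hω hs f‖ =
        (eLpNorm (leftTranslate s f) p (weightedMeasure μ p ω)).toReal :=
      Lp.norm_toLp _ (memLp_leftTranslate hω hs (Lp.memLp f))
    rw [h1, Lp.norm_def, ← ENNReal.toReal_mul]
    exact ENNReal.toReal_mono (ENNReal.mul_ne_top hs.ne (Lp.eLpNorm_ne_top f))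
      (eLpNorm_leftTranslate_le h0 hp hω hs (Lp.memLp f))

theorem coeFn_leftTranslateCLM [Fact (1 ≤ p)] (hp : p ≠ ∞) (hω : IsWeight μ p ω) {s : G}
    (hs : translationBound μ ω s < ∞) (f : WeightedLp μ p ω) :
    leftTranslateCLM hp hω hs f =ᵐ[weightedMeasure μ p ω] leftTranslate s f :=
  MemLp.coeFn_toLp (memLp_leftTranslate hω hs (Lp.memLp f))

omit [TopologicalSpace G] [IsTopologicalGroup G] [BorelSpace G] [μ.IsMulLeftInvariant] in
theorem IsDenseVector.exists_eLpNorm_sub_lt [Fact (1 ≤ p)] {Γ : Set ℂ} {S : Set G}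
    {f : WeightedLp μ p ω} (hf : IsDenseVector μ p ω Γ S f) {g : G → ℂ}
    (hg : MemLp g p (weightedMeasure μ p ω)) {δ : ℝ≥0∞} (hδ : δ ≠ 0) :
    ∃ c ∈ Γ, ∃ s ∈ S,
      eLpNorm (fun t => c * f (s⁻¹ * t) - g t) p (weightedMeasure μ p ω) < δ := by
  obtain ⟨a, ⟨c, hc, s, hs, ha⟩, hlt⟩ :=
    EMetric.mem_closure_iff.1 (hf (hg.toLp g)) δ (pos_iff_ne_zero.2 hδ)
  refine ⟨c, hc, s, hs, lt_of_eq_of_lt ?_ hlt⟩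
  rw [edist_comm, Lp.edist_def]
  refine eLpNorm_congr_ae ?_
  filter_upwards [ha, hg.coeFn_toLp] with t h1 h2
  simp [h1, h2, leftTranslate]

end Translation

/-- An integrable function vanishes almost everywhere off a countable union of compact sets. -/
theorem exists_seq_isCompact_ae_mem {α : Type*} [TopologicalSpace α] [R1Space α]
    [MeasurableSpace α] [BorelSpace α] {μ : Measure α} [μ.Regular] {g : α → ℝ}
    (hg : Integrable g μ) :
    ∃ K : ℕ → Set α, (∀ n, IsCompact (K n)) ∧ ∀ᵐ t ∂μ, g t ≠ 0 → ∃ n, t ∈ K n := by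
  obtain ⟨g', hg'm, hgg'⟩ := hg.1
  have hg' : Integrable g' μ := hg.congr hgg'
  -- The superlevel sets of an integrable function have finite measure, so inner regularity exhausts
  -- each by compact sets up to a null set.
  have h1 : ∀ n k : ℕ, ∃ K ⊆ {t | (n + 1 : ℝ)⁻¹ ≤ ‖g' t‖}, IsCompact K ∧ IsClosed K ∧
      μ ({t | (n + 1 : ℝ)⁻¹ ≤ ‖g' t‖} \ K) < (k + 1 : ℝ≥0∞)⁻¹ := fun n k =>
    (measurableSet_le measurable_const hg'm.measurable.norm).exists_isCompact_isClosed_sdiff_lt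
      (hg'.measure_norm_ge_lt_top (by positivity)).ne (ENNReal.inv_ne_zero.2 (by finiteness))
  choose K hsub hK hcl hlt using h1
  refine ⟨fun j => K j.unpair.1 j.unpair.2, fun j => hK _ _, ?_⟩
  have h2 : ∀ n : ℕ, ∀ᵐ t ∂μ, (n + 1 : ℝ)⁻¹ ≤ ‖g' t‖ → ∃ k, t ∈ K n k := by
    intro n
    refine measure_mono_null (t := ⋂ k, {t | (n + 1 : ℝ)⁻¹ ≤ ‖g' t‖} \ K n k) ?_ ?_
    · intro t ht
      simp only [Set.mem_compl_iff, Set.mem_ofPred_eq, not_forall, not_exists] at ht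
      exact Set.mem_iInter.2 fun k => ⟨ht.1, ht.2 k⟩
    · refine le_antisymm (ge_of_tendsto' (x := atTop)
        ((tendsto_add_atTop_iff_nat 1).2 ENNReal.tendsto_inv_nat_nhds_zero) fun k => ?_) zero_le
      refine (measure_mono (Set.iInter_subset _ k)).trans ?_
      simpa using (hlt n k).le
  filter_upwards [ae_all_iff.2 h2, hgg'] with t ht heq hne
  rw [heq] at hne
  obtain ⟨n, hn⟩ := exists_nat_one_div_lt (norm_pos_iff.2 hne)
  obtain ⟨k, hk⟩ := ht n (by simpa using hn.le)
  exact ⟨Nat.pair n k, by simpa using hk⟩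

/-! ### A dense vector makes the group `σ`-compact and second countable. -/

section Countability

variable {G : Type*} [Group G] [TopologicalSpace G] [IsTopologicalGroup G]
  [LocallyCompactSpace G] [T2Space G] [MeasurableSpace G] [BorelSpace G]
  {μ : Measure G} [μ.IsHaarMeasure] [μ.Regular] {p : ℝ≥0∞} [Fact (1 ≤ p)]
  {S : Set G} {Γ : Set ℂ} {ω : G → ℝ}

omit [LocallyCompactSpace G] [T2Space G] [μ.IsHaarMeasure] in
/-- An element of `L^p(G, ω)` vanishes almost everywhere off a countable union of compact sets. -/
theorem exists_seq_isCompact_ae_mem_of_memLp (hp : p ≠ ∞) (hω : IsWeight μ p ω)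
    (f : WeightedLp μ p ω) :
    ∃ K : ℕ → Set G, (∀ n, IsCompact (K n)) ∧ ∀ᵐ t ∂μ, f t ≠ 0 → ∃ n, t ∈ K n := by
  have hp0 : p ≠ 0 := (zero_lt_one.trans_le (Fact.out : 1 ≤ p)).ne'
  have h1 := (integrable_withDensity_iff_integrable_smul₀' hω.aemeasurable_density
    (.of_forall fun t => (density_ne_top t).lt_top)).1
    ((Lp.memLp f).integrable_norm_rpow hp0 hp)
  obtain ⟨K, hK, h⟩ := exists_seq_isCompact_ae_mem h1
  refine ⟨K, hK, h.mono fun t ht hne => ht ?_⟩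
  refine smul_ne_zero (ENNReal.toReal_ne_zero.2 ⟨hω.density_ne_zero t, density_ne_top t⟩) ?_
  exact (Real.rpow_pos_of_pos (norm_pos_iff.2 hne) _).ne'

omit [Group G] [IsTopologicalGroup G] [μ.IsHaarMeasure] [LocallyCompactSpace G] [μ.Regular]
  [Fact (1 ≤ p)] in
theorem memLp_indicator_one (hω : IsWeight μ p ω) {K : Set G} (hK : IsCompact K) :
    MemLp (K.indicator fun _ => (1 : ℂ)) p (weightedMeasure μ p ω) :=
  memLp_indicator_const p hK.measurableSet 1
    (Or.inr (hω.weightedMeasure_lt_top hK hK.measurableSet).ne)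

omit [IsTopologicalGroup G] [BorelSpace G] [LocallyCompactSpace G] [μ.Regular] [T2Space G]
  [Fact (1 ≤ p)] in
theorem IsWeight.weightedMeasure_pos_of_nhds (hω : IsWeight μ p ω) {K : Set G} {x : G}
    (hK : K ∈ 𝓝 x) : 0 < weightedMeasure μ p ω K :=
  pos_iff_ne_zero.2 fun h => (Measure.measure_pos_of_mem_nhds μ hK).ne'
    (hω.absolutelyContinuous_weightedMeasure h)

/-- If `L^p(G, ω)` has a dense vector, then `G` is `σ`-compact. -/
theorem IsDenseVector.sigmaCompactSpace (hp : p ≠ ∞) (hω : IsWeight μ p ω)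
    {f : WeightedLp μ p ω} (hf : IsDenseVector μ p ω Γ S f) : SigmaCompactSpace G := by
  have hp0 : p ≠ 0 := (zero_lt_one.trans_le (Fact.out : 1 ≤ p)).ne'
  obtain ⟨C, hC, hfC⟩ := exists_seq_isCompact_ae_mem_of_memLp hp hω f
  obtain ⟨V, hV, hV1⟩ := exists_compact_mem_nhds (1 : G)
  -- If some `x` lies outside `E`, no `s` lets both `s⁻¹ V` and `s⁻¹ x V` meet the sets `C n`
  -- carrying `f`. But approximating the indicator of `V ∪ x V` by a multiple of `T_s f` needs
  -- exactly that.
  set E : Set G := ⋃ ij : ℕ × ℕ, V * (C ij.1)⁻¹ * C ij.2 * V⁻¹ with hE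
  have hEσ : IsSigmaCompact E := isSigmaCompact_iUnion_of_isCompact _ fun ij =>
    ((hV.mul (hC _).inv).mul (hC _)).mul hV.inv
  by_cases hEu : E = Set.univ
  · exact isSigmaCompact_univ_iff.1 (hEu ▸ hEσ)
  exfalso
  obtain ⟨x, hx⟩ := (Set.ne_univ_iff_exists_notMem E).1 hEu
  have hxV : IsCompact (x • V) := hV.smul x
  have hxVn : x • V ∈ 𝓝 x := by simpa using smul_mem_nhds_smul x hV1
  set ν := weightedMeasure μ p ω
  have hmin : min (ν V) (ν (x • V)) ≠ 0 :=
    (lt_min (hω.weightedMeasure_pos_of_nhds hV1) (hω.weightedMeasure_pos_of_nhds hxVn)).ne'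
  obtain ⟨δ, hδ, hsmall⟩ := exists_pos_measure_le_norm_lt (E := ℂ) (ν := ν) hp0 hp one_pos hmin
  have hg := memLp_indicator_one hω (hV.union hxV)
  obtain ⟨c, -, s, -, hlt⟩ := hf.exists_eLpNorm_sub_lt hg hδ.ne'
  have hfs : Measurable fun t => f (s⁻¹ * t) :=
    (Lp.stronglyMeasurable f).measurable.comp (measurable_const_mul _)
  have hu := hsmall _ ((hfs.const_mul c).aestronglyMeasurable.sub hg.1) hlt
  have hfC' : ∀ᵐ t ∂ν, f (s⁻¹ * t) ≠ 0 → ∃ n, s⁻¹ * t ∈ C n :=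
    weightedMeasure_absolutelyContinuous.ae_le
      ((measurePreserving_mul_left μ s⁻¹).quasiMeasurePreserving.ae hfC)
  have key : ∀ W ⊆ V ∪ x • V, min (ν V) (ν (x • V)) ≤ ν W → ∃ t ∈ W, ∃ n, s⁻¹ * t ∈ C n := by
    intro W hW hle
    by_contra! hcon
    refine (hu.trans_le hle).not_ge (measure_mono_ae ?_)
    filter_upwards [hfC'] with t ht htW
    have h0 : f (s⁻¹ * t) = 0 := by
      by_contra h
      obtain ⟨n, hn⟩ := ht h
      exact hcon t htW n hn
    change 1 ≤ ‖c * f (s⁻¹ * t) - _‖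
    rw [h0, Set.indicator_of_mem (hW htW)]
    simp
  obtain ⟨t, ht, i, hi⟩ := key V Set.subset_union_left (min_le_left _ _)
  obtain ⟨t', ⟨v, hv, rfl⟩, j, hj⟩ := key _ Set.subset_union_right (min_le_right _ _)
  refine hx (Set.mem_iUnion.2 ⟨(i, j), ?_⟩)
  have : x = t * (s⁻¹ * t)⁻¹ * (s⁻¹ * (x • v)) * v⁻¹ := by simp [mul_assoc]
  rw [this]
  exact Set.mul_mem_mul (Set.mul_mem_mul (Set.mul_mem_mul ht (Set.inv_mem_inv.2 hi)) hj)
    (Set.inv_mem_inv.2 hv)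

omit [T2Space G] in
/-- Right translations preserve the null sets of a left Haar measure. -/
theorem quasiMeasurePreserving_mul_right_of_innerRegular (μ : Measure G) [μ.IsHaarMeasure]
    [μ.InnerRegular] (v : G) : Measure.QuasiMeasurePreserving (· * v) μ μ where
  measurable := measurable_mul_const v
  absolutelyContinuous := by
    rw [Measure.map_right_mul_eq_modularCharacterFun_smul μ v]
    exact Measure.smul_absolutelyContinuous

omit [LocallyCompactSpace G] [T2Space G] [MeasurableSpace G] [BorelSpace G] in
theorem eventually_forall_dist_mul_right_lt {φ : G → ℂ} (hc : Continuous φ)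
    (hs : HasCompactSupport φ) {ε : ℝ} (hε : 0 < ε) :
    ∀ᶠ v in 𝓝 (1 : G), ∀ t, dist (φ (t * v)) (φ t) < ε := by
  -- In the left uniformity the pair `(t, t * v)` is close uniformly in `t`, because `t⁻¹ (t v) =
  -- v`.
  let _ := IsTopologicalGroup.leftUniformSpace G
  have h := hs.uniformContinuous_of_continuous hc (Metric.dist_mem_uniformity hε)
  obtain ⟨W, hW, hWs⟩ := mem_comap.1 h
  filter_upwards [hW] with v hv t
  have h2 : (t, t * v) ∈ (fun q : G × G => q.1⁻¹ * q.2) ⁻¹' W := by simpa using hv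
  rw [dist_comm]
  exact hWs h2

omit [LocallyCompactSpace G] [T2Space G] [MeasurableSpace G] [BorelSpace G] in
/-- Compactly supported continuous functions on a group are uniformly continuous, so they are
invariant under any right translation lying in suitable countably many neighbourhoods of `1`. -/
theorem exists_seq_nhds_forall_mul_right_eq {φ : ℕ → G → ℂ} (hc : ∀ n, Continuous (φ n))
    (hs : ∀ n, HasCompactSupport (φ n)) :
    ∃ W : ℕ → Set G, (∀ n, W n ∈ 𝓝 1) ∧ ∀ v, (∀ n, v ∈ W n) → ∀ n t, φ n (t * v) = φ n t := by
  refine ⟨fun j => {v | ∀ t, dist (φ j.unpair.1 (t * v)) (φ j.unpair.1 t) < (j.unpair.2 + 1 : ℝ)⁻¹},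
    fun j => eventually_forall_dist_mul_right_lt (hc _) (hs _) (by positivity),
    fun v hv n t => dist_le_zero.1 (ge_of_tendsto' (x := atTop)
      tendsto_one_div_add_atTop_nhds_zero_nat fun k => ?_)⟩
  simpa using (hv (Nat.pair n k) t).le

/-- For an almost everywhere defined function `f` on a `σ`-compact group there are countably many
neighbourhoods of `1` such that `f` is invariant under right translation by every point of their
intersection. -/
theorem exists_seq_nhds_ae_mul_right_eq [SigmaCompactSpace G] (μ : Measure G) [μ.IsHaarMeasure]
    [μ.Regular] {f : G → ℂ} (hf : Measurable f) :
    ∃ W : ℕ → Set G, (∀ n, W n ∈ 𝓝 1) ∧ ∀ v, (∀ n, v ∈ W n) → ∀ᵐ t ∂μ, f (t * v) = f t := by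
  set K := fun n => compactCovering G n
  have hK : ∀ n, IsCompact (K n) := isCompact_compactCovering G
  -- `f` itself need not be integrable. The sets `B n` have finite measure, bound `f`, and
  -- eventually contain each point.
  set B : ℕ → Set G := fun n => K n ∩ {t | ‖f t‖ ≤ n}
  have hB : ∀ n, MeasurableSet (B n) := fun n =>
    (hK n).measurableSet.inter (measurableSet_le hf.norm measurable_const)
  have hint : ∀ n, Integrable ((B n).indicator f) μ := by
    intro n
    rw [integrable_indicator_iff (hB n)]
    refine Measure.integrableOn_of_bounded (M := n)
      ((measure_mono Set.inter_subset_left).trans_lt (hK n).measure_lt_top).ne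
      hf.aestronglyMeasurable ?_
    exact (ae_restrict_iff' (hB n)).2 (.of_forall fun t ht => ht.2)
  choose φ hc hs hφ using fun n => exists_seq_hasCompactSupport_tendsto_ae (hint n)
  obtain ⟨W, hW, hWφ⟩ := exists_seq_nhds_forall_mul_right_eq
    (φ := fun j => φ j.unpair.1 j.unpair.2) (fun j => hc _ _) (fun j => hs _ _)
  refine ⟨W, hW, fun v hv => ?_⟩
  have h1 : ∀ᵐ t ∂μ, ∀ n, Tendsto (fun k => φ n k t) atTop (𝓝 ((B n).indicator f t)) :=
    ae_all_iff.2 hφ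
  -- Right translation preserves null sets, so the approximants converge at `t * v` as well as at
  -- `t`. Their values there coincide.
  filter_upwards [h1, (quasiMeasurePreserving_mul_right_of_innerRegular μ v).ae h1] with t ht htv
  have h2 : ∀ n, (B n).indicator f (t * v) = (B n).indicator f t := fun n => by
    refine tendsto_nhds_unique (htv n) ((ht n).congr fun k => ?_)
    have := hWφ v hv (Nat.pair n k) t
    simpa using this.symm
  have h3 : ∀ t, ∀ᶠ n in atTop, (B n).indicator f t = f t := by
    intro t
    obtain ⟨n, hn⟩ := exists_mem_compactCovering t
    obtain ⟨m, hm⟩ := exists_nat_ge ‖f t‖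
    filter_upwards [eventually_ge_atTop n, eventually_ge_atTop m] with k hk hk'
    have hB : t ∈ B k := ⟨compactCovering_subset G hk hn, hm.trans (by exact_mod_cast hk')⟩
    exact Set.indicator_of_mem hB _
  obtain ⟨n, hn1, hn2⟩ := ((h3 t).and (h3 (t * v))).exists
  rw [← hn1, ← hn2, h2 n]

/-- If `L^p(G, ω)` has a dense vector, invariant under right translation by `v`, then `v = 1`. -/
theorem IsDenseVector.eq_one_of_mul_right_eq [SigmaCompactSpace G] (hω : IsWeight μ p ω)
    {f : WeightedLp μ p ω} (hf : IsDenseVector μ p ω Γ S f) {v : G}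
    (hv : ∀ᵐ t ∂μ, f (t * v) = f t) : v = 1 := by
  by_contra hne
  have hp0 : p ≠ 0 := (zero_lt_one.trans_le (Fact.out : 1 ≤ p)).ne'
  -- The indicator of such an `A` changes under right translation by `v` at every point of `A`.
  obtain ⟨A, hA, hA1, hdisj⟩ : ∃ A : Set G, IsCompact A ∧ A ∈ 𝓝 1 ∧ ∀ t ∈ A, t * v ∉ A := by
    obtain ⟨U, O, hU, hO, hUO⟩ := t2_separation_nhds (Ne.symm hne)
    have h1 : ∀ᶠ t in 𝓝 (1 : G), t * v ∈ O :=
      (continuous_mul_const v).continuousAt.eventually_mem (by simpa using hO)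
    obtain ⟨A, hA1, hAU, hA⟩ := LocallyCompactSpace.local_compact_nhds (1 : G) _ (inter_mem hU h1)
    exact ⟨A, hA, hA1, fun t ht htv =>
      Set.disjoint_left.1 hUO (hAU htv).1 (hAU ht).2⟩
  have hg := memLp_indicator_one hω hA
  set g : G → ℂ := A.indicator fun _ => (1 : ℂ)
  choose c _ s _ hlt using fun n : ℕ => hf.exists_eLpNorm_sub_lt hg
    (δ := (n + 1 : ℝ≥0∞)⁻¹) (ENNReal.inv_ne_zero.2 (by finiteness))
  have hfs : ∀ n, Measurable fun t => c n * f ((s n)⁻¹ * t) := fun n =>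
    ((Lp.stronglyMeasurable f).measurable.comp (measurable_const_mul _)).const_mul _
  have hlim : Tendsto (fun n => eLpNorm ((fun t => c n * f ((s n)⁻¹ * t)) - g) p
      (weightedMeasure μ p ω)) atTop (𝓝 0) := by
    refine tendsto_of_tendsto_of_tendsto_of_le_of_le tendsto_const_nhds
      ((tendsto_add_atTop_iff_nat 1).2 ENNReal.tendsto_inv_nat_nhds_zero) (fun _ => zero_le)
      fun n => ?_
    rw [Nat.cast_add, Nat.cast_one]
    exact (hlt n).le
  obtain ⟨ns, -, hns⟩ := (tendstoInMeasure_of_tendsto_eLpNorm hp0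
    (fun n => (hfs n).aestronglyMeasurable) hg.1 hlim).exists_seq_tendsto_ae
  have hns' := hω.absolutelyContinuous_weightedMeasure.ae_le hns
  -- Left and right translations commute, so invariance under `v` passes from `f` to its translates,
  -- and then to their almost everywhere limit `g`.
  have hinv : ∀ᵐ t ∂μ, ∀ n, f ((s n)⁻¹ * (t * v)) = f ((s n)⁻¹ * t) := by
    refine ae_all_iff.2 fun n => ?_
    filter_upwards [(measurePreserving_mul_left μ (s n)⁻¹).quasiMeasurePreserving.ae hv] with t ht
    rw [← ht, mul_assoc]
  have hae : ∀ᵐ t ∂μ, g (t * v) = g t := by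
    filter_upwards [hns', (quasiMeasurePreserving_mul_right_of_innerRegular μ v).ae hns', hinv]
      with t h1 h2 h3
    exact tendsto_nhds_unique h2 (h1.congr fun n => by rw [h3])
  refine (Measure.measure_pos_of_mem_nhds μ hA1).ne' (measure_mono_null (fun t ht => ?_) hae)
  simp [g, ht, hdisj t ht]

omit [MeasurableSpace G] [BorelSpace G] in
/-- A `σ`-compact locally compact group in which `1` is the only common point of some countable
family of neighbourhoods is second countable. -/
theorem secondCountableTopology_of_seq_nhds [SigmaCompactSpace G] {W : ℕ → Set G}
    (hW : ∀ n, W n ∈ 𝓝 (1 : G)) (h : ∀ v, (∀ n, v ∈ W n) → v = 1) :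
    SecondCountableTopology G := by
  choose U hU hUW hUc using fun n => LocallyCompactSpace.local_compact_nhds (1 : G) (W n) (hW n)
  have hb : (𝓝 (1 : G)).IsCountablyGenerated := by
    -- The finite intersections of the compact sets `U i` decrease to `{1}`, so by compactness they
    -- enter every neighbourhood of `1`.
    refine HasBasis.isCountablyGenerated (ι := ℕ) (p := fun _ => True)
      (s := fun n => ⋂ i ∈ Set.Iic n, U i) ⟨fun O => ⟨fun hO => ?_, fun ⟨n, _, hn⟩ =>
        mem_of_superset ((biInter_mem (Set.finite_Iic n)).2 fun i _ => hU i) hn⟩⟩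
    have hcl : ∀ i, IsClosed (U i) := fun i => (hUc i).isClosed
    have hdir : Directed (· ⊇ ·) fun n => ⋂ i ∈ Set.Iic n, U i := directed_of_isDirected_le
      fun m n hmn => Set.biInter_subset_biInter_left (Set.Iic_subset_Iic.2 hmn)
    have hcpt : ∀ n, IsCompact (⋂ i ∈ Set.Iic n, U i) := fun n => (hUc n).of_isClosed_subset
      (isClosed_biInter fun i _ => hcl i) (Set.biInter_subset_of_mem (Set.mem_Iic.2 le_rfl))
    obtain ⟨n, hn⟩ := exists_subset_nhds_of_isCompact hdir hcpt (U := O) fun x hx => by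
      rw [h x fun n => hUW n (Set.mem_iInter₂.1 (Set.mem_iInter.1 hx n) n (Set.mem_Iic.2 le_rfl))]
      exact hO
    exact ⟨n, trivial, hn⟩
  -- A countable basis at `1` makes the left uniformity countably generated, hence pseudometrizable;
  -- a `σ`-compact pseudometric space is second countable.
  let _ := IsTopologicalGroup.leftUniformSpace G
  have : (uniformity G).IsCountablyGenerated := Filter.comap.isCountablyGenerated _ _
  let _ := UniformSpace.pseudoMetricSpace G
  exact EMetric.secondCountable_of_sigmaCompact G

/-- If `L^p(G, ω)` has a dense vector, then `G` is second countable. -/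
theorem IsDenseVector.secondCountableTopology [SigmaCompactSpace G] (hω : IsWeight μ p ω)
    {f : WeightedLp μ p ω} (hf : IsDenseVector μ p ω Γ S f) : SecondCountableTopology G := by
  obtain ⟨W, hW, h⟩ := exists_seq_nhds_ae_mul_right_eq μ (Lp.stronglyMeasurable f).measurable
  exact secondCountableTopology_of_seq_nhds hW fun v hv => hf.eq_one_of_mul_right_eq hω (h v hv)

end Countability

/-- The ratios `a / b ≈ 1 + i` and `a' / b' ≈ 1 + j` are equal. Cross-multiplied to avoid division,
the error in `i - j` is below `2 η + 2 (N + 2) η`, which is less than `1` for `η = 1 / (4 (N + 2))`.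
-/
theorem eq_of_norm_sub_lt_of_mul_eq_mul {N i j : ℕ} (hi : i ≤ N) (hj : j ≤ N) {a b a' b' : ℂ} {η : ℝ}
    (hη : η * (4 * (N + 2)) = 1) (ha : ‖a - (1 + i)‖ < η) (hb : ‖b - 1‖ < η)
    (ha' : ‖a' - (1 + j)‖ < η) (hb' : ‖b' - 1‖ < η) (h : a * b' = a' * b) : i = j := by
  have hη0 : 0 < η := (norm_nonneg _).trans_lt ha
  have hη1 : η ≤ 1 := by nlinarith [(Nat.cast_nonneg N : (0 : ℝ) ≤ N)]
  have bound : ∀ (k : ℕ) (z : ℂ), k ≤ N → ‖z - (1 + k)‖ < η → ‖z‖ ≤ N + 2 := by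
    intro k z hk hz
    have h1 : ‖z‖ ≤ ‖z - (1 + k)‖ + ‖(1 + k : ℂ)‖ := by
      simpa using norm_add_le (z - (1 + k)) (1 + k)
    have h2 : ‖(1 + k : ℂ)‖ = 1 + k := by
      rw [show (1 + k : ℂ) = ((1 + k : ℕ) : ℂ) by push_cast; ring, Complex.norm_natCast]
      push_cast; ring
    have h3 : (k : ℝ) ≤ N := by exact_mod_cast hk
    linarith
  have hdiff : ((i : ℂ) - j) = -(a - (1 + i)) - a * (b' - 1) + a' * (b - 1) + (a' - (1 + j)) := by
    linear_combination h
  have h1 : ‖a * (b' - 1)‖ ≤ (N + 2) * η := by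
    rw [norm_mul]
    exact mul_le_mul (bound i a hi ha) hb'.le (norm_nonneg _) (by positivity)
  have h2 : ‖a' * (b - 1)‖ ≤ (N + 2) * η := by
    rw [norm_mul]
    exact mul_le_mul (bound j a' hj ha') hb.le (norm_nonneg _) (by positivity)
  have h3 : ‖((i : ℂ) - j)‖ < 1 := by
    rw [hdiff]
    refine (norm_add_le _ _).trans_lt ?_
    refine lt_of_le_of_lt (b := η + (N + 2) * η + (N + 2) * η + η) ?_ (by nlinarith)
    refine add_le_add ((norm_add_le _ _).trans (add_le_add ((norm_sub_le _ _).trans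
      (add_le_add ?_ h1)) h2)) ha'.le
    rw [norm_neg]
    exact ha.le
  have h4 : ‖(((i : ℤ) - j : ℤ) : ℂ)‖ < 1 := by push_cast; exact h3
  rw [Complex.norm_intCast] at h4
  have h5 : |(i : ℤ) - j| < 1 := by exact_mod_cast h4
  have := Int.abs_lt_one_iff.1 h5
  omega

/-! ### Approximating translations can leave every compact set. -/

section Escape

variable {G : Type*} [Group G] [TopologicalSpace G] [IsTopologicalGroup G]
  [LocallyCompactSpace G] [T2Space G] [MeasurableSpace G] [BorelSpace G]
  {μ : Measure G} [μ.IsHaarMeasure] [μ.Regular] {p : ℝ≥0∞} [Fact (1 ≤ p)]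
  {S : Set G} {Γ : Set ℂ} {ω : G → ℝ}

omit [MeasurableSpace G] [BorelSpace G] in
/-- A non-trivial group has two disjoint right translates of a compact neighbourhood of `1` that
remain disjoint after thickening. -/
theorem exists_isCompact_disjoint_mul [Nontrivial G] :
    ∃ (V : Set G) (y : G), IsCompact V ∧ V ∈ 𝓝 1 ∧ Disjoint (V * V) (V * (V * {y})) := by
  obtain ⟨y, hy⟩ := exists_ne (1 : G)
  obtain ⟨U, O, hU, hO, hUO⟩ := t2_separation_nhds hy.symm
  have h1 : ∀ᶠ t in 𝓝 (1 : G), t * y ∈ O :=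
    (continuous_mul_const y).continuousAt.eventually_mem (by simpa using hO)
  obtain ⟨W, hW, hWm⟩ := exists_nhds_one_split (inter_mem hU h1)
  obtain ⟨V, hV1, hVW, hV⟩ := LocallyCompactSpace.local_compact_nhds (1 : G) _ hW
  refine ⟨V, y, hV, hV1, hUO.mono ?_ ?_⟩
  · rintro _ ⟨v, hv, w, hw, rfl⟩
    exact (hWm v (hVW hv) w (hVW hw)).1
  · rintro _ ⟨v, hv, _, ⟨w, hw, _, rfl, rfl⟩, rfl⟩
    simpa [mul_assoc] using (hWm v (hVW hv) w (hVW hw)).2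

omit [IsTopologicalGroup G] [LocallyCompactSpace G] [T2Space G] [BorelSpace G] [μ.Regular] in
/-- Two sets of small measure cannot cover a set and its translate. -/
theorem exists_mem_notMem_mul_notMem [MeasurableMul G] {Z F E₁ E₂ : Set G} {v : G} (hZ : Z ⊆ F)
    (hvZ : ∀ t ∈ Z, v * t ∈ F) {ε : ℝ≥0∞} (hε : ε ≤ μ Z / 2) (h₁ : μ (E₁ ∩ F) < ε)
    (h₂ : μ (E₂ ∩ F) < ε) : ∃ t ∈ Z, t ∉ E₁ ∧ v * t ∉ E₂ := by
  by_contra! hcon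
  have hsub : Z ⊆ E₁ ∩ F ∪ (v * ·) ⁻¹' (E₂ ∩ F) := fun t ht => by
    by_cases h : t ∈ E₁
    · exact Or.inl ⟨h, hZ ht⟩
    · exact Or.inr ⟨hcon t ht h, hvZ t ht⟩
  refine ((measure_mono hsub).trans (measure_union_le (μ := μ) _ _)).not_gt ?_
  rw [measure_preimage_mul]
  calc μ (E₁ ∩ F) + μ (E₂ ∩ F) < ε + ε := ENNReal.add_lt_add h₁ h₂
    _ ≤ μ Z / 2 + μ Z / 2 := add_le_add hε hε
    _ = μ Z := ENNReal.add_halves _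

omit [LocallyCompactSpace G] [T2Space G] [MeasurableSpace G] [BorelSpace G] in
/-- Among sufficiently many points of a compact set, two differ by an element of a given
neighbourhood of `1`. -/
theorem exists_forall_exists_ne_mul_inv_mem {D V : Set G} (hD : IsCompact D) (hV : V ∈ 𝓝 (1 : G)) :
    ∃ N : ℕ, ∀ s : ℕ → G, (∀ i ≤ N, s i ∈ D) → ∃ i ≤ N, ∃ j ≤ N, i ≠ j ∧ s j * (s i)⁻¹ ∈ V := by
  obtain ⟨W, hW, hWV⟩ : ∃ W ∈ 𝓝 (1 : G), ∀ v ∈ W, ∀ w ∈ W, v * w⁻¹ ∈ V := by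
    obtain ⟨W, hW, h⟩ := exists_nhds_split_inv hV
    exact ⟨W, hW, fun v hv w hw => by simpa [div_eq_mul_inv] using h v hv w hw⟩
  obtain ⟨T, -, hT⟩ := hD.elim_nhds_subcover (fun x => {s | s * x⁻¹ ∈ W}) fun x _ =>
    (continuous_mul_const x⁻¹).continuousAt.preimage_mem_nhds (by simpa using hW)
  -- The indices `0, …, N` give `N + 1` points for `N` covering sets, so two share one.
  refine ⟨T.card, fun s hs => ?_⟩
  have h1 : ∀ i ≤ T.card, ∃ x ∈ T, s i * x⁻¹ ∈ W := fun i hi => by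
    simpa using hT (hs i hi)
  choose! x hx hxW using h1
  obtain ⟨i, hi, j, hj, hij, heq⟩ := Finset.exists_ne_map_eq_of_card_lt_of_maps_to
    (s := Finset.range (T.card + 1)) (t := T) (f := x) (by simp)
    fun i hi => hx i (Nat.lt_succ_iff.1 (Finset.mem_range.1 hi))
  have hi' := Nat.lt_succ_iff.1 (Finset.mem_range.1 hi)
  have hj' := Nat.lt_succ_iff.1 (Finset.mem_range.1 hj)
  refine ⟨i, hi', j, hj', hij, ?_⟩
  have h2 := hWV _ (hxW j hj') _ (hxW i hi')
  rw [← heq] at h2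
  simpa using h2

omit [μ.Regular] in
/-- A dense vector on a non-trivial group has scaled translates by elements `s` moving a given
compact set `E` off a given compact set `F` that approximate functions of modulus at least `1`
on `F` and vanishing off `F`. -/
theorem IsDenseVector.exists_eLpNorm_sub_lt_of_isCompact [Nontrivial G] (hp : p ≠ ∞)
    (hω : IsWeight μ p ω) {f : WeightedLp μ p ω} (hf : IsDenseVector μ p ω Γ S f) :
    ∃ F₀ : Set G, IsCompact F₀ ∧ ∀ F E : Set G, F₀ ⊆ F → IsCompact F → IsCompact E →
      ∀ δ : ℝ≥0∞, δ ≠ 0 → ∃ c ∈ Γ, ∃ s ∈ S, (∀ t ∈ E, s * t ∉ F) ∧ ∃ h : G → ℂ,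
        (∀ t ∈ F, 1 ≤ ‖h t‖) ∧ (∀ t ∉ F, h t = 0) ∧
        AEStronglyMeasurable h (weightedMeasure μ p ω) ∧
        eLpNorm (fun t => c * f (s⁻¹ * t) - h t) p (weightedMeasure μ p ω) < δ := by
  have hp0 : p ≠ 0 := (zero_lt_one.trans_le (Fact.out : 1 ≤ p)).ne'
  obtain ⟨V, y, hV, hV1, hdisj⟩ := exists_isCompact_disjoint_mul (G := G)
  have h1V : (1 : G) ∈ V := mem_of_mem_nhds hV1
  set A := V * V
  set Z := V * {y}
  set B := V * Z
  have hA : IsCompact A := hV.mul hV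
  have hZ : IsCompact Z := hV.mul isCompact_singleton
  have hVA : V ⊆ A := fun v hv => ⟨1, h1V, v, hv, one_mul v⟩
  have hZB : Z ⊆ B := fun v hv => ⟨1, h1V, v, hv, one_mul v⟩
  refine ⟨A ∪ B, hA.union (hV.mul hZ), fun F E hF hFc hE δ hδ => ?_⟩
  have hAF : A ⊆ F := Set.subset_union_left.trans hF
  have hBF : B ⊆ F := Set.subset_union_right.trans hF
  -- Two exceptional sets of measure below `ε` cannot exhaust `V` or `Z`, even after one of them is
  -- translated.
  set ε := min (μ V / 2) (μ Z / 2)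
  have hε : ε ≠ 0 := by
    have h1 : 0 < μ V := Measure.measure_pos_of_mem_nhds μ hV1
    have h2 : 0 < μ Z := by
      refine Measure.measure_pos_of_mem_nhds μ (x := y) ?_
      have h3 := (Homeomorph.mulRight y).isOpenMap.image_mem_nhds hV1
      simpa [Z, Set.mul_singleton] using h3
    exact (lt_min (ENNReal.half_pos h1.ne') (ENNReal.half_pos h2.ne')).ne'
  obtain ⟨N, hN⟩ := exists_forall_exists_ne_mul_inv_mem (hFc.mul hE.inv) hV1
  set η : ℝ := (4 * (N + 2))⁻¹
  have hη : 0 < η := by positivity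
  obtain ⟨δ₁, hδ₁, hμ⟩ := hω.exists_pos_measure_inter_lt hFc.measurableSet hFc.measure_lt_top.ne hε
  obtain ⟨δ₂, hδ₂, hν⟩ := exists_pos_measure_le_norm_lt (E := ℂ) (ν := weightedMeasure μ p ω)
    hp0 hp hη hδ₁.ne'
  -- The target `h i` is `1 + i` on `A` and `1` on `B`, so the ratio of its values on the two sets
  -- identifies `i`.
  set h : ℕ → G → ℂ := fun i =>
    (F.indicator fun _ => (1 : ℂ)) + (i : ℂ) • A.indicator fun _ => (1 : ℂ)
  have hh : ∀ i, MemLp (h i) p (weightedMeasure μ p ω) := fun i =>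
    (memLp_indicator_one hω hFc).add ((memLp_indicator_one hω hA).const_smul _)
  have hhA : ∀ i, ∀ t ∈ A, h i t = 1 + i := fun i t ht => by simp [h, ht, hAF ht]
  have hhF : ∀ i, ∀ t ∈ F, t ∉ A → h i t = 1 := fun i t ht htA => by simp [h, ht, htA]
  choose c hc s hs hlt using fun i => hf.exists_eLpNorm_sub_lt (hh i) (lt_min hδ.bot_lt hδ₂).ne'
  by_cases hall : ∃ i, ∀ t ∈ E, s i * t ∉ F
  · obtain ⟨i, hi⟩ := hall
    refine ⟨c i, hc i, s i, hs i, hi, h i, fun t ht => ?_, fun t ht => ?_, (hh i).1,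
      (hlt i).trans_le (min_le_left _ _)⟩
    · by_cases htA : t ∈ A
      · rw [hhA i t htA, show (1 + i : ℂ) = ((1 + i : ℕ) : ℂ) by push_cast; ring,
          Complex.norm_natCast]
        push_cast
        linarith [(Nat.cast_nonneg i : (0 : ℝ) ≤ i)]
      · simp [hhF i t ht htA]
    · simp [h, ht, show t ∉ A from fun htA => ht (hAF htA)]
  exfalso
  push Not at hall
  have hD : ∀ i, s i ∈ F * E⁻¹ := fun i => by
    obtain ⟨t, ht, htF⟩ := hall i
    exact ⟨_, htF, t⁻¹, Set.inv_mem_inv.2 ht, by simp⟩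
  obtain ⟨i, hi, j, hj, hij, hv⟩ := hN s fun i _ => hD i
  set v := s j * (s i)⁻¹ with hvdef
  set bad : ℕ → Set G := fun i => {t | η ≤ ‖c i * f ((s i)⁻¹ * t) - h i t‖}
  have hbad : ∀ i, μ (bad i ∩ F) < ε := fun i => by
    refine hμ _ (hν _ ?_ ((hlt i).trans_le (min_le_right _ _)))
    exact (((Lp.stronglyMeasurable f).measurable.comp (measurable_const_mul _)).const_mul
      (c i)).aestronglyMeasurable.sub (hh i).1
  -- The translate by `s j` at `v t` and the translate by `s i` at `t` read the same value of `f`.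
  have hshift : ∀ t, (s j)⁻¹ * (v * t) = (s i)⁻¹ * t := fun t => by simp [hvdef, mul_assoc]
  obtain ⟨t, ht, hti, htj⟩ := exists_mem_notMem_mul_notMem (hVA.trans hAF)
    (fun t ht => hAF ⟨v, hv, t, ht, rfl⟩) (min_le_left _ _) (hbad i) (hbad j)
  obtain ⟨t', ht', hti', htj'⟩ := exists_mem_notMem_mul_notMem (hZB.trans hBF)
    (fun t ht => hBF ⟨v, hv, t, ht, rfl⟩) (min_le_right _ _) (hbad i) (hbad j)
  have hvt' : v * t' ∈ B := ⟨v, hv, t', ht', rfl⟩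
  simp only [bad, Set.mem_ofPred_eq, not_le] at hti htj hti' htj'
  rw [hshift] at htj htj'
  rw [hhA i t (hVA ht)] at hti
  rw [hhA j _ ⟨v, hv, t, ht, rfl⟩] at htj
  rw [hhF i t' (hBF (hZB ht')) (Set.disjoint_right.1 hdisj (hZB ht'))] at hti'
  rw [hhF j _ (hBF hvt') (Set.disjoint_right.1 hdisj hvt')] at htj'
  -- With `x = (s i)⁻¹ t` and `x' = (s i)⁻¹ t'`, both products equal `c i * c j * f x * f x'`.
  exact hij (eq_of_norm_sub_lt_of_mul_eq_mul hi hj (inv_mul_cancel₀ (by positivity))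
    hti hti' htj htj' (by ring))

end Escape

/-- Recursive choice of a sequence, each term of which satisfies a condition of its own and a
condition relating it to every earlier term. -/
theorem exists_seq_forall_lt {α : Type*} [Nonempty α] {P : ℕ → α → Prop}
    {R : ℕ → ℕ → α → α → Prop}
    (h : ∀ (n : ℕ) (a : ℕ → α), ∃ y, P n y ∧ ∀ m < n, R m n (a m) y) :
    ∃ a : ℕ → α, ∀ n, P n (a n) ∧ ∀ m < n, R m n (a m) (a n) := by
  choose F hF using h
  -- `b n` records the first `n` choices; its remaining values are arbitrary.
  let b : ℕ → ℕ → α := fun n =>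
    Nat.rec (fun _ => Classical.arbitrary α) (fun n b => Function.update b n (F n b)) n
  have hb : ∀ n m, m < n → b n m = F m (b m) := by
    intro n
    induction n with
    | zero => intro m hm; omega
    | succ n ih =>
      intro m hm
      change Function.update (b n) n (F n (b n)) m = _
      rcases Nat.lt_succ_iff_lt_or_eq.1 hm with h | rfl
      · rw [Function.update_of_ne h.ne, ih m h]
      · rw [Function.update_self]
  refine ⟨fun n => F n (b n), fun n => ⟨(hF n (b n)).1, fun m hm => ?_⟩⟩
  have := (hF n (b n)).2 m hm
  rwa [hb n m hm] at this

theorem MeasureTheory.Lp.norm_le_mul_of_ae_le_mul {α E F : Type*} {m : MeasurableSpace α}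
    [NormedAddCommGroup E] [NormedAddCommGroup F] {ν : Measure α} {p : ℝ≥0∞} (v : Lp E p ν)
    {w : α → F} {C ε : ℝ} (hC : 0 ≤ C) (hε : 0 ≤ ε) (h : ∀ᵐ t ∂ν, ‖v t‖ ≤ C * ‖w t‖)
    (hw : eLpNorm w p ν ≤ ENNReal.ofReal ε) : ‖v‖ ≤ C * ε := by
  rw [Lp.norm_def]
  refine ENNReal.toReal_le_of_le_ofReal (by positivity) ?_
  rw [ENNReal.ofReal_mul hC]
  exact (eLpNorm_le_mul_eLpNorm_of_ae_le_mul h p).trans (mul_le_mul_right hw _)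

/-! ### Targets and the sequence of scalars and translations. -/

section Construction

variable {G : Type*} [Group G] [TopologicalSpace G] [IsTopologicalGroup G]
  [LocallyCompactSpace G] [T2Space G] [MeasurableSpace G] [BorelSpace G]
  {μ : Measure G} [μ.IsHaarMeasure] {p : ℝ≥0∞} [Fact (1 ≤ p)]
  {S : Set G} {Γ Γ' : Set ℂ} {ω : G → ℝ}

omit [Fact (1 ≤ p)] [Group G] [IsTopologicalGroup G] [μ.IsHaarMeasure] in
theorem IsWeight.isLocallyFiniteMeasure (hω : IsWeight μ p ω) :
    IsLocallyFiniteMeasure (weightedMeasure μ p ω) := by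
  have : IsFiniteMeasureOnCompacts (weightedMeasure μ p ω) :=
    ⟨fun K hK => hω.weightedMeasure_lt_top hK hK.measurableSet⟩
  infer_instance

omit [Fact (1 ≤ p)] [Group G] [IsTopologicalGroup G] in
/-- The mass of an element of `L^p` off suitable compact sets is small. -/
theorem exists_isCompact_eLpNorm_indicator_le [SecondCountableTopology G] {ν : Measure G}
    [IsLocallyFiniteMeasure ν] (hp : p ≠ ∞) {w : G → ℂ} (hw : MemLp w p ν) {ε : ℝ≥0∞}
    (hε : ε ≠ 0) :
    ∃ K : Set G, IsCompact K ∧ ∀ T : Set G, Disjoint T K → eLpNorm (T.indicator w) p ν ≤ ε := by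
  obtain ⟨φ, hφ, hle, -, -⟩ := hw.exists_hasCompactSupport_eLpNorm_sub_le hp hε
  refine ⟨tsupport φ, hφ, fun T hT => le_trans (eLpNorm_mono fun t => ?_) hle⟩
  by_cases ht : t ∈ T
  · have h0 : φ t = 0 := image_eq_zero_of_notMem_tsupport (Set.disjoint_left.1 hT ht)
    simp [ht, h0]
  · simp [ht]

omit [Group G] [IsTopologicalGroup G] in
/-- There is a sequence of compactly supported continuous functions all of whose tails are dense
in `L^p`. -/
theorem exists_seq_hasCompactSupport_dense [SecondCountableTopology G] (ν : Measure G)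
    [IsLocallyFiniteMeasure ν] (hp : p ≠ ∞) :
    ∃ (g : ℕ → G → ℂ) (hg : ∀ n, MemLp (g n) p ν), (∀ n, Continuous (g n)) ∧
      (∀ n, HasCompactSupport (g n)) ∧
      ∀ (x : Lp ℂ p ν) (ε : ℝ), 0 < ε → ∀ k, ∃ n ≥ k, ‖x - (hg n).toLp (g n)‖ < ε := by
  have : Fact (p ≠ ∞) := ⟨hp⟩
  have hx := TopologicalSpace.denseRange_denseSeq (Lp ℂ p ν)
  set x := TopologicalSpace.denseSeq (Lp ℂ p ν)
  choose φ hφ hle hc hm using fun i k : ℕ => (Lp.memLp (x i)).exists_hasCompactSupport_eLpNorm_sub_le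
    hp (ε := ENNReal.ofReal (k + 1 : ℝ)⁻¹) (by simpa using by positivity)
  refine ⟨fun j => φ j.unpair.1 j.unpair.2, fun j => hm _ _, fun j => hc _ _, fun j => hφ _ _,
    fun y ε hε k => ?_⟩
  obtain ⟨i, hi⟩ := Metric.denseRange_iff.1 hx y (ε / 2) (half_pos hε)
  obtain ⟨l, hl⟩ := exists_nat_one_div_lt (half_pos hε)
  set r := max k l
  -- `r` serves both purposes: it makes the approximation to `x i` accurate and pushes the paired
  -- index past `k`.
  refine ⟨Nat.pair i r, (le_max_left k l).trans (Nat.right_le_pair i r), ?_⟩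
  have h1 : ‖x i - (hm i r).toLp (φ i r)‖ ≤ (r + 1 : ℝ)⁻¹ := by
    rw [Lp.norm_def]
    refine ENNReal.toReal_le_of_le_ofReal (by positivity) ((eLpNorm_congr_ae ?_).trans_le (hle i r))
    filter_upwards [Lp.coeFn_sub (x i) ((hm i r).toLp (φ i r)), (hm i r).coeFn_toLp] with t h1 h2
    rw [h1, Pi.sub_apply, h2, Pi.sub_apply]
  have h2 : (r + 1 : ℝ)⁻¹ < ε / 2 := by
    refine lt_of_le_of_lt ?_ hl
    rw [one_div]
    exact inv_anti₀ (by positivity) (by gcongr; exact le_max_right k l)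
  have h3 : ‖y - x i‖ < ε / 2 := by rwa [← dist_eq_norm]
  simp only [Nat.unpair_pair]
  calc ‖y - (hm i r).toLp (φ i r)‖ = ‖(y - x i) + (x i - (hm i r).toLp (φ i r))‖ := by
        rw [sub_add_sub_cancel]
    _ < ε := by linarith [norm_add_le (y - x i) (x i - (hm i r).toLp (φ i r))]

/-- A sequence `(c n, s n)` of scalars and translations for which the translates of `f` by `s n`
nearly separate the compact sets `F n`. -/
theorem IsDenseVector.exists_seq [Nontrivial G] [SecondCountableTopology G] (hp : p ≠ ∞)
    (hω : IsWeight μ p ω) (hS : IsAdmissible μ ω S) {f : WeightedLp μ p ω}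
    (hf : IsDenseVector μ p ω Γ S f) {K : ℕ → Set G} (hK : ∀ n, IsCompact (K n)) {ε : ℕ → ℝ}
    (hε : ∀ n, 0 < ε n) :
    ∃ (F : ℕ → Set G) (c : ℕ → ℂ) (s : ℕ → G), (∀ n, IsCompact (F n)) ∧ (∀ n, K n ⊆ F n) ∧
      (∀ n, c n ∈ Γ) ∧ (∀ n, s n ∈ S) ∧
      (∀ n, eLpNorm ({t | s n * t ∈ F n}.indicator f) p (weightedMeasure μ p ω) ≤
        ENNReal.ofReal (ε n)) ∧
      (∀ n, ∃ h : G → ℂ, (∀ t ∈ F n, 1 ≤ ‖h t‖) ∧ (∀ t ∉ F n, h t = 0) ∧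
        eLpNorm (fun t => c n * f ((s n)⁻¹ * t) - h t) p (weightedMeasure μ p ω) ≤
          ENNReal.ofReal (ε n)) ∧
      (∀ m n, m < n → ∀ t, s m * t ∈ F m → s n * t ∉ F n) ∧
      (∀ m n, m < n → eLpNorm ({t | s n * ((s m)⁻¹ * t) ∈ F n}.indicator
        fun t => c m * f ((s m)⁻¹ * t)) p (weightedMeasure μ p ω) ≤ ENNReal.ofReal (ε n)) := by
  have := hω.isLocallyFiniteMeasure
  obtain ⟨F₀, hF₀, H⟩ := hf.exists_eLpNorm_sub_lt_of_isCompact hp hω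
  set F : ℕ → Set G := fun n => F₀ ∪ K n
  have hF : ∀ n, IsCompact (F n) := fun n => hF₀.union (hK n)
  have hne : Nonempty (Γ × S) := by
    obtain ⟨c, hc, s, hs, -⟩ := H F₀ ∅ subset_rfl hF₀ isCompact_empty 1 one_ne_zero
    exact ⟨⟨c, hc⟩, ⟨s, hs⟩⟩
  obtain ⟨a, ha⟩ := exists_seq_forall_lt (α := Γ × S)
    (P := fun n y =>
      eLpNorm ({t | (y.2 : G) * t ∈ F n}.indicator f) p (weightedMeasure μ p ω) ≤
        ENNReal.ofReal (ε n) ∧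
      ∃ h : G → ℂ, (∀ t ∈ F n, 1 ≤ ‖h t‖) ∧ (∀ t ∉ F n, h t = 0) ∧
        eLpNorm (fun t => y.1 * f ((y.2 : G)⁻¹ * t) - h t) p (weightedMeasure μ p ω) ≤
          ENNReal.ofReal (ε n))
    (R := fun m n x y => (∀ t, (x.2 : G) * t ∈ F m → (y.2 : G) * t ∉ F n) ∧
      eLpNorm ({t | (y.2 : G) * ((x.2 : G)⁻¹ * t) ∈ F n}.indicator
        fun t => x.1 * f ((x.2 : G)⁻¹ * t)) p (weightedMeasure μ p ω) ≤ ENNReal.ofReal (ε n))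
    (by
      intro n a
      have hεn : ENNReal.ofReal (ε n) ≠ 0 := by simpa using hε n
      obtain ⟨C₀, hC₀, hC₀f⟩ := exists_isCompact_eLpNorm_indicator_le hp (Lp.memLp f) hεn
      choose C hC hCf using fun m => exists_isCompact_eLpNorm_indicator_le hp
        ((memLp_leftTranslate hω (hS _ (a m).2.2) (Lp.memLp f)).const_mul ((a m).1 : ℂ)) hεn
      -- Moving `E` off `F n` gives all three smallness conditions: `C₀` carries almost all of `f`,
      -- `C m` almost all of `c m T_{s m} f`, and `(s m)⁻¹ F m` is where the earlier pieces live.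
      set E : Set G := C₀ ∪ ⋃ m ∈ Finset.range n, ((a m).2 : G)⁻¹ • (C m ∪ F m)
      have hE : IsCompact E := hC₀.union ((Finset.range n).isCompact_biUnion fun m _ =>
        ((hC m).union (hF m)).smul _)
      obtain ⟨c, hc, s, hs, hsE, h, h1, h0, -, hlt⟩ :=
        H (F n) E Set.subset_union_left (hF n) hE _ hεn
      have hsub : ∀ m < n, ∀ t, ((a m).2 : G) * t ∈ C m ∪ F m → s * t ∉ F n := by
        intro m hm t ht
        refine hsE t (Or.inr (Set.mem_biUnion (Finset.mem_coe.2 (Finset.mem_range.2 hm)) ?_))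
        exact ⟨_, ht, by simp⟩
      refine ⟨(⟨c, hc⟩, ⟨s, hs⟩), ⟨hC₀f _ (Set.disjoint_right.2 fun t ht => hsE t (Or.inl ht)),
        h, h1, h0, hlt.le⟩, fun m hm => ⟨fun t ht => hsub m hm t (Or.inr ht),
        hCf m _ (Set.disjoint_right.2 fun t ht => ?_)⟩⟩
      exact hsub m hm _ (Or.inl (by simpa using ht)))
  exact ⟨F, fun n => (a n).1, fun n => (a n).2, hF, fun n => Set.subset_union_right,
    fun n => (a n).1.2, fun n => (a n).2.2, fun n => (ha n).1.1, fun n => (ha n).1.2,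
    fun m n hmn => ((ha n).2 m hmn).1, fun m n hmn => ((ha n).2 m hmn).2⟩

end Construction

/-! ### Assembling the new dense vector. -/

section Main

variable {G : Type*} [Group G] [TopologicalSpace G] [IsTopologicalGroup G]
  [LocallyCompactSpace G] [T2Space G] [MeasurableSpace G] [BorelSpace G]
  {μ : Measure G} [μ.IsHaarMeasure] {p : ℝ≥0∞} [Fact (1 ≤ p)]
  {S : Set G} {Γ Γ' : Set ℂ} {ω : G → ℝ}

open Classical in
/-- The function that is `c'⁻¹ g (s t)` where `s t ∈ F` and `f` is at least `1 / (2 |c|)`. -/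
noncomputable def translatePiece (F : Set G) (f g : G → ℂ) (c c' : ℂ) (s : G) : G → ℂ := fun t =>
  if s * t ∈ F ∧ 1 / 2 ≤ ‖c * f t‖ then c'⁻¹ * g (s * t) else 0

omit [TopologicalSpace G] [IsTopologicalGroup G] [LocallyCompactSpace G] [T2Space G]
  [MeasurableSpace G] [BorelSpace G] in
-- The threshold `|c f t| ≥ 1/2` turns `|c'|⁻¹ = |c|⁻¹` into at most `2 |f t|`. This is what makes
-- the pieces small wherever `f` is.
theorem norm_translatePiece_le {F : Set G} {f g : G → ℂ} {c c' : ℂ} {s : G} {B : ℝ}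
    (hg : ∀ t, ‖g t‖ ≤ B) (hc : ‖c'‖ = ‖c‖) (t : G) :
    ‖translatePiece F f g c c' s t‖ ≤ 2 * B * ‖({t | s * t ∈ F}.indicator f) t‖ := by
  have hB : 0 ≤ B := (norm_nonneg _).trans (hg 1)
  unfold translatePiece
  split_ifs with h
  · rw [Set.indicator_of_mem (show t ∈ {t | s * t ∈ F} from h.1), norm_mul, norm_inv, hc]
    have h2 := h.2
    rw [norm_mul] at h2
    have hc0 : 0 < ‖c‖ := by
      rcases (norm_nonneg c).eq_or_lt with h0 | h0
      · rw [← h0] at h2; norm_num at h2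
      · exact h0
    have h3 : ‖c‖⁻¹ ≤ 2 * ‖f t‖ := by
      rw [inv_le_iff_one_le_mul₀ hc0]; linarith
    calc ‖c‖⁻¹ * ‖g (s * t)‖ ≤ (2 * ‖f t‖) * B :=
          mul_le_mul h3 (hg _) (norm_nonneg _) (by positivity)
      _ = 2 * B * ‖f t‖ := by ring
  · rw [norm_zero]; positivity

omit [LocallyCompactSpace G] [T2Space G] in
theorem measurable_translatePiece {F : Set G} (hF : MeasurableSet F) {f g : G → ℂ}
    (hf : Measurable f) (hg : Measurable g) (c c' : ℂ) (s : G) :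
    Measurable (translatePiece F f g c c' s) := by
  refine Measurable.ite ?_ ((hg.comp (measurable_const_mul s)).const_mul _) measurable_const
  exact (measurable_const_mul s hF).inter
    (measurableSet_le measurable_const (hf.const_mul c).norm)

omit [TopologicalSpace G] [IsTopologicalGroup G] [LocallyCompactSpace G] [T2Space G]
  [MeasurableSpace G] [BorelSpace G] in
/-- The piece attached to `(c, s)`, moved by `(c', s)`, agrees with `g` where `c T_s f` is large. -/
theorem norm_mul_translatePiece_sub_le {F : Set G} {f g h : G → ℂ} {c c' : ℂ} {s : G} {B : ℝ}
    (hg : ∀ t, ‖g t‖ ≤ B) (hgF : ∀ t ∉ F, g t = 0) (hh : ∀ t ∈ F, 1 ≤ ‖h t‖) (hc : ‖c'‖ = ‖c‖)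
    (t : G) : ‖c' * translatePiece F f g c c' s (s⁻¹ * t) - g t‖ ≤
      2 * B * ‖c * f (s⁻¹ * t) - h t‖ := by
  have hB : 0 ≤ B := (norm_nonneg _).trans (hg 1)
  unfold translatePiece
  rw [mul_inv_cancel_left]
  split_ifs with ht
  · have hc0 : c' ≠ 0 := by
      rintro rfl
      rw [norm_zero] at hc
      have h2 := ht.2
      rw [norm_mul, ← hc] at h2
      norm_num at h2
    rw [mul_inv_cancel_left₀ hc0, sub_self, norm_zero]
    positivity
  · rw [mul_zero, zero_sub, norm_neg]
    by_cases htF : t ∈ F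
    · have h1 : ‖c * f (s⁻¹ * t)‖ < 1 / 2 := by
        by_contra hcon
        exact ht ⟨htF, not_lt.1 hcon⟩
      have h2 : 1 / 2 ≤ ‖c * f (s⁻¹ * t) - h t‖ := by
        have := norm_sub_norm_le (h t) (c * f (s⁻¹ * t))
        rw [norm_sub_rev] at this
        linarith [hh t htF]
      nlinarith [hg t]
    · rw [hgF t htF, norm_zero]
      positivity

/-- A dense vector for `Γ` gives one for every set of scalars containing an element of each modulus
that occurs in `Γ`. -/
theorem IsDenseVector.exists_of_norm_eq_of_secondCountable [Nontrivial G]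
    [SecondCountableTopology G] (hp : p ≠ ∞)
    (hω : IsWeight μ p ω) (hS : IsAdmissible μ ω S) {f : WeightedLp μ p ω}
    (hf : IsDenseVector μ p ω Γ S f) (hΓ : ∀ c ∈ Γ, ∃ c' ∈ Γ', ‖c'‖ = ‖c‖) :
    ∃ f' : WeightedLp μ p ω, IsDenseVector μ p ω Γ' S f' := by
  have := hω.isLocallyFiniteMeasure
  obtain ⟨g, hgm, hgc, hgs, hgd⟩ :=
    exists_seq_hasCompactSupport_dense (weightedMeasure μ p ω) hp
  choose b hb using fun n => (hgs n).exists_bound_of_continuous (hgc n)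
  -- The bounds are made monotone so that, for `n < m`, `ε m` also absorbs the factor `2 * B n`.
  set B : ℕ → ℝ := fun n => 1 + ∑ i ∈ Finset.range (n + 1), |b i| with hBdef
  have hB1 : ∀ n, 1 ≤ B n := fun n => by
    have : 0 ≤ ∑ i ∈ Finset.range (n + 1), |b i| := Finset.sum_nonneg fun i _ => abs_nonneg _
    simp only [hBdef]; linarith
  have hBmono : ∀ m n, m ≤ n → B m ≤ B n := fun m n hmn =>
    add_le_add le_rfl (Finset.sum_le_sum_of_subset_of_nonneg
      (Finset.range_subset_range.2 (by omega)) fun i _ _ => abs_nonneg _)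
  have hgB : ∀ n t, ‖g n t‖ ≤ B n := fun n t => by
    have h1 : |b n| ≤ ∑ i ∈ Finset.range (n + 1), |b i| :=
      Finset.single_le_sum (f := fun i => |b i|) (fun i _ => abs_nonneg _) (by simp)
    simp only [hBdef]
    linarith [hb n t, le_abs_self (b n)]
  set ε : ℕ → ℝ := fun n => (1 / 4) ^ n / (2 * B n)
  have hε : ∀ n, 0 < ε n := fun n => by
    have := hB1 n
    positivity
  have hBε : ∀ n, 2 * B n * ε n = (1 / 4) ^ n := fun n => by
    have := hB1 n
    simp only [ε]
    field_simp
  obtain ⟨F, c, s, hF, hKF, hc, hs, hmass, happ, hdisj, hlater⟩ :=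
    hf.exists_seq hp hω hS (K := fun n => tsupport (g n)) hgs hε
  choose h hh1 hh0 hhε using happ
  choose c' hc' hcc' using fun n => hΓ (c n) (hc n)
  have hgF : ∀ n, ∀ t ∉ F n, g n t = 0 := fun n t ht =>
    image_eq_zero_of_notMem_tsupport fun h => ht (hKF n h)
  have hfm : Measurable f := (Lp.stronglyMeasurable f).measurable
  set u : ℕ → G → ℂ := fun n => translatePiece (F n) f (g n) (c n) (c' n) (s n)
  have hule : ∀ n t, ‖u n t‖ ≤ 2 * B n * ‖({t | s n * t ∈ F n}.indicator f) t‖ := fun n t =>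
    norm_translatePiece_le (hgB n) (hcc' n) t
  have hum : ∀ n, MemLp (u n) p (weightedMeasure μ p ω) := fun n => by
    refine (Lp.memLp f).of_le_mul (c := 2 * B n) (measurable_translatePiece (hF n).measurableSet hfm
      (hgc n).measurable _ _ _).aestronglyMeasurable (.of_forall fun t => (hule n t).trans ?_)
    have := hB1 n
    gcongr
    exact norm_indicator_le_norm_self _ _
  set U : ℕ → WeightedLp μ p ω := fun n => (hum n).toLp (u n)
  have hU : ∀ n, ‖U n‖ ≤ (1 / 4) ^ n := fun n => by
    rw [← hBε n]
    refine Lp.norm_le_mul_of_ae_le_mul _ (by linarith [hB1 n]) (hε n).le ?_ (hmass n)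
    filter_upwards [(hum n).coeFn_toLp] with t ht
    rw [ht]
    exact hule n t
  have hsum : HasSum U (∑' n, U n) := (Summable.of_norm_bounded
    (summable_geometric_of_lt_one (by norm_num) (by norm_num)) hU).hasSum
  set f' := ∑' n, U n
  refine ⟨f', ?_⟩
  have key : ∀ m, ‖c' m • leftTranslateCLM hp hω (hS _ (hs m)) f' - (hgm m).toLp (g m)‖ ≤
      (1 / 2) ^ m * 2 := by
    intro m
    set T := leftTranslateCLM hp hω (hS _ (hs m))
    -- Subtracting `g m` from the `m`-th term alone leaves a series whose `n`-th term is to be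
    -- bounded by `2⁻ᵐ 2⁻ⁿ`.
    have hsumV := ((hsum.mapL T).const_smul (c' m)).sub (hasSum_ite_eq m ((hgm m).toLp (g m)))
    refine hsumV.norm_le_of_bounded (hasSum_geometric_two.mul_left _) fun n => ?_
    have hTU : ∀ᵐ t ∂(weightedMeasure μ p ω), (c' m • T (U n)) t = c' m * u n ((s m)⁻¹ * t) := by
      filter_upwards [Lp.coeFn_smul (c' m) (T (U n)),
        coeFn_leftTranslateCLM hp hω (hS _ (hs m)) (U n),
        leftTranslate_congr_ae hω (s m) (hum n).coeFn_toLp] with t h1 h2 h3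
      rw [h1, Pi.smul_apply, h2, h3, smul_eq_mul]
      rfl
    have hmul : ∀ t, ‖c' m * u n ((s m)⁻¹ * t)‖ ≤ 2 * B n *
        ‖({t | s n * ((s m)⁻¹ * t) ∈ F n}.indicator fun t => c m * f ((s m)⁻¹ * t)) t‖ := by
      intro t
      rw [norm_mul, hcc' m]
      refine (mul_le_mul_of_nonneg_left (hule n _) (norm_nonneg _)).trans_eq ?_
      by_cases ht : s n * ((s m)⁻¹ * t) ∈ F n
      · simp [ht]; ring
      · simp [ht]
    have hpow : ∀ k, m ≤ k → n ≤ k → (1 / 4 : ℝ) ^ k ≤ (1 / 2) ^ m * (1 / 2) ^ n := by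
      intro k hmk hnk
      rw [show (1 / 4 : ℝ) = 1 / 2 * (1 / 2) by norm_num, mul_pow]
      exact mul_le_mul (pow_le_pow_of_le_one (by norm_num) (by norm_num) hmk)
        (pow_le_pow_of_le_one (by norm_num) (by norm_num) hnk) (by positivity) (by positivity)
    -- For `n < m` the term lives where `h m = 0`, so there `c m T_{s m} f` is itself the
    -- approximation error. For `n = m` the piece reproduces `g m` up to that error. For `n > m` the
    -- choice of `s n` makes `c m T_{s m} f` small on the set carrying the term.
    rcases lt_trichotomy n m with hnm | rfl | hnm
    · rw [if_neg hnm.ne, sub_zero]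
      refine (Lp.norm_le_mul_of_ae_le_mul _ (C := 2 * B n) (by linarith [hB1 n]) (hε m).le ?_
        (hhε m)).trans ?_
      · filter_upwards [hTU] with t ht
        rw [ht]
        refine (hmul t).trans ?_
        have := hB1 n
        gcongr
        by_cases htn : s n * ((s m)⁻¹ * t) ∈ F n
        · have h0 : h m t = 0 := hh0 m t fun htm =>
            hdisj n m hnm _ htn (by simpa using htm)
          simp [htn, h0]
        · simp [htn]
      · refine le_trans ?_ (hpow m le_rfl hnm.le)
        rw [← hBε m]
        exact mul_le_mul_of_nonneg_right (by linarith [hBmono n m hnm.le]) (hε m).le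
    · rw [if_pos rfl]
      refine (Lp.norm_le_mul_of_ae_le_mul _ (C := 2 * B n) (by linarith [hB1 n]) (hε n).le ?_
        (hhε n)).trans ?_
      · filter_upwards [hTU, Lp.coeFn_sub (c' n • T (U n)) ((hgm n).toLp (g n)),
          (hgm n).coeFn_toLp] with t h1 h2 h3
        rw [h2, Pi.sub_apply, h1, h3]
        exact norm_mul_translatePiece_sub_le (hgB n) (hgF n) (hh1 n) (hcc' n) t
      · rw [hBε n]
        exact hpow n le_rfl le_rfl
    · rw [if_neg hnm.ne', sub_zero]
      refine (Lp.norm_le_mul_of_ae_le_mul _ (C := 2 * B n) (by linarith [hB1 n]) (hε n).le ?_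
        (hlater m n hnm)).trans ?_
      · filter_upwards [hTU] with t ht
        rw [ht]
        exact hmul t
      · rw [hBε n]
        exact hpow n hnm.le le_rfl
  refine Metric.dense_iff.2 fun x r hr => ?_
  -- The error `2 * 2⁻ᵐ` from `key` falls below `r / 2` once `m ≥ k`; density of every tail of the
  -- targets supplies such an `m`.
  obtain ⟨k, hk⟩ := exists_pow_lt_of_lt_one (show (0 : ℝ) < r / 4 by positivity)
    (show (1 / 2 : ℝ) < 1 by norm_num)
  obtain ⟨m, hmk, hm⟩ := hgd x (r / 2) (half_pos hr) k
  refine ⟨c' m • leftTranslateCLM hp hω (hS _ (hs m)) f', ?_, c' m, hc' m, s m, hs m, ?_⟩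
  · rw [Metric.mem_ball, dist_eq_norm]
    have h1 : (1 / 2 : ℝ) ^ m ≤ (1 / 2) ^ k :=
      pow_le_pow_of_le_one (by norm_num) (by norm_num) hmk
    have h2 := norm_sub_le_norm_sub_add_norm_sub
      (c' m • leftTranslateCLM hp hω (hS _ (hs m)) f') ((hgm m).toLp (g m)) x
    rw [norm_sub_rev x] at hm
    linarith [key m]
  · filter_upwards [Lp.coeFn_smul (c' m) (leftTranslateCLM hp hω (hS _ (hs m)) f'),
      coeFn_leftTranslateCLM hp hω (hS _ (hs m)) f'] with t h1 h2
    rw [h1, Pi.smul_apply, h2, Pi.smul_apply]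

/-- Second countability is no extra assumption: the given dense vector already forces it. -/
theorem IsDenseVector.exists_of_norm_eq [Nontrivial G] [μ.Regular] (hp : p ≠ ∞)
    (hω : IsWeight μ p ω) (hS : IsAdmissible μ ω S) {f : WeightedLp μ p ω}
    (hf : IsDenseVector μ p ω Γ S f) (hΓ : ∀ c ∈ Γ, ∃ c' ∈ Γ', ‖c'‖ = ‖c‖) :
    ∃ f' : WeightedLp μ p ω, IsDenseVector μ p ω Γ' S f' := by
  have := hf.sigmaCompactSpace hp hω
  have := hf.secondCountableTopology hω
  exact hf.exists_of_norm_eq_of_secondCountable hp hω hS hΓ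

theorem exists_isDenseVector_iff_absSet [Nontrivial G] [μ.Regular] (hp : p ≠ ∞)
    (hω : IsWeight μ p ω) (hS : IsAdmissible μ ω S) (Γ : Set ℂ) :
    (∃ f : WeightedLp μ p ω, IsDenseVector μ p ω Γ S f) ↔
      ∃ f : WeightedLp μ p ω, IsDenseVector μ p ω (absSet Γ) S f := by
  refine ⟨fun ⟨f, hf⟩ => hf.exists_of_norm_eq hp hω hS fun c hc => ⟨_, ⟨c, hc, rfl⟩, by simp⟩,
    fun ⟨f, hf⟩ => hf.exists_of_norm_eq hp hω hS ?_⟩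
  rintro _ ⟨c, hc, rfl⟩
  exact ⟨c, hc, by simp⟩

theorem absSet_univ : absSet Set.univ = nonnegReals := by
  ext z
  constructor
  · rintro ⟨c, -, rfl⟩
    exact ⟨‖c‖, norm_nonneg c, rfl⟩
  · rintro ⟨r, hr, rfl⟩
    exact ⟨(r : ℂ), trivial, by simp [abs_of_nonneg (Set.mem_Ici.1 hr)]⟩

end Main

theorem mainTheorem4 {G : Type*} [Group G] [TopologicalSpace G] [IsTopologicalGroup G]
    [LocallyCompactSpace G] [T2Space G] [Nontrivial G] [MeasurableSpace G] [BorelSpace G]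
    (μ : Measure G) [μ.IsHaarMeasure] [μ.Regular]
    (p : ℝ≥0∞) [Fact (1 ≤ p)] (hp : p ≠ ∞) (S : Set G)
    (ω : G → ℝ) (hω : IsWeight μ p ω) (hS : IsAdmissible μ ω S) :
    (∀ Γ : Set ℂ,
      (∃ f : WeightedLp μ p ω, IsDenseVector μ p ω Γ S f) ↔
        ∃ f : WeightedLp μ p ω, IsDenseVector μ p ω (absSet Γ) S f) ∧
    ((∃ f : WeightedLp μ p ω, IsDenseVector μ p ω nonnegReals S f) ↔
      ∃ f : WeightedLp μ p ω, IsDenseVector μ p ω Set.univ S f) := by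
  refine ⟨exists_isDenseVector_iff_absSet hp hω hS, ?_⟩
  rw [← absSet_univ]
  exact (exists_isDenseVector_iff_absSet hp hω hS Set.univ).symm
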